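/- Let $r\in\mathbb N$, $V=\mathbb R^r$, and for $\alpha\in V^*$ write $\alpha^\perp=\ker\alpha$. Let $\mathcal A=\{H_1,\dots,H_n\}$ be a simplicial arrangement in $V$, i.e. a finite set of distinct linear hyperplanes such that every connected component (chamber) of $V\setminus\bigcup_{H\in\mathcal A}H$ is an open simplicial cone $\{\sum_{i=1}^r a_i v_i \mid a_i>0 \text{ for all } i\}$ for some basis $v_1,\dots,v_r$ of $V$. For each $i$ choose $x_i\in V^*$ with $x_i^\perp=H_i$, and let $R=\{\pm x_1,\dots,\pm x_n\}$. For a chamber $K$ let \[ W^K=\{H\in\mathcal A \mid \dim(H\cap\overline K)=r-1\},\qquad B^K=\{\alpha\in R \mid \alpha^\perp\in W^K,\ \alpha\ge 0 \text{ on } K\},\qquad R^K_+=R\cap\sum_{\alpha\in B^K}\mathbb R_{\ge 0}\,\alpha, \] where $\overline K$ is the closure of $K$ and the dimension of a cone is that of its linear span. Call $(\mathcal A,R)$ crystallographic if $R\subseteq\sum_{\alpha\in B^K}\mathbb Z\alpha$ for every chamber $K$, and additive if for every chamber $K$ and every $\alpha\in R^K_+\setminus B^K$ there exist $\beta,\gamma\in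 R^K_+$ with $\alpha=\beta+\gamma$. Then $(\mathcal A,R)$ is crystallographic if and only if it is additive. -/

import Mathlib

namespace Arrangement

/-- The complement in `ℝ^r` of the union of the hyperplanes in `A`. -/
def complement {r : ℕ} (A : Set (Submodule ℝ (Fin r → ℝ))) : Set (Fin r → ℝ) :=
  (⋃ H ∈ A, (H : Set (Fin r → ℝ)))ᶜ

/-- The chambers: the connected components of the complement of the union of the hyperplanes. -/
def chambers {r : ℕ} (A : Set (Submodule ℝ (Fin r → ℝ))) : Set (Set (Fin r → ℝ)) :=
  {K | ∃ v ∈ complement A, K = connectedComponentIn (complement A) v}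

/-- `K` is the set of all positive linear combinations of some basis of `ℝ^r`. -/
def IsOpenSimplicialCone {r : ℕ} (K : Set (Fin r → ℝ)) : Prop :=
  ∃ b : Module.Basis (Fin r) ℝ (Fin r → ℝ),
    K = {v | ∃ a : Fin r → ℝ, (∀ i, 0 < a i) ∧ v = ∑ i, a i • b i}

/-- A simplicial arrangement: a finite set of linear hyperplanes all of whose chambers are open
simplicial cones. -/
structure IsSimplicial {r : ℕ} (A : Set (Submodule ℝ (Fin r → ℝ))) : Prop where
  finite : A.Finite
  hyperplane : ∀ H ∈ A, Module.finrank ℝ H + 1 = r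
  simplicial : ∀ K ∈ chambers A, IsOpenSimplicialCone K

/-- `R = {± x_H | H ∈ A}` for some choice of linear forms `x_H` with kernel `H`, one for each
`H ∈ A`. -/
def IsRootSet {r : ℕ} (A : Set (Submodule ℝ (Fin r → ℝ)))
    (R : Set (Module.Dual ℝ (Fin r → ℝ))) : Prop :=
  ∃ x : Submodule ℝ (Fin r → ℝ) → Module.Dual ℝ (Fin r → ℝ),
    (∀ H ∈ A, LinearMap.ker (x H) = H) ∧ R = {α | ∃ H ∈ A, α = x H ∨ α = -x H}

/-- The closed half-space `N(α)` on which `α` is nonnegative. -/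
def halfSpace {r : ℕ} (α : Module.Dual ℝ (Fin r → ℝ)) : Set (Fin r → ℝ) :=
  {v | 0 ≤ α v}

/-- The walls `W^K`: hyperplanes `H ∈ A` with `dim (H ∩ closure K) = r - 1`. The dimension of the
cone `H ∩ closure K` is the dimension of its linear span. -/
def walls {r : ℕ} (A : Set (Submodule ℝ (Fin r → ℝ))) (K : Set (Fin r → ℝ)) :
    Set (Submodule ℝ (Fin r → ℝ)) :=
  {H | H ∈ A ∧
    Module.finrank ℝ (Submodule.span ℝ ((H : Set (Fin r → ℝ)) ∩ closure K)) + 1 = r}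

/-- `B^K`: the elements of `R` that are normal to a wall of `K` and point to the inside. -/
def simpleRoots {r : ℕ} (A : Set (Submodule ℝ (Fin r → ℝ)))
    (R : Set (Module.Dual ℝ (Fin r → ℝ))) (K : Set (Fin r → ℝ)) :
    Set (Module.Dual ℝ (Fin r → ℝ)) :=
  {α | α ∈ R ∧ LinearMap.ker α ∈ walls A K ∧ halfSpace α ∩ K = K}

/-- `R^K_+`: the elements of `R` that are nonnegative real combinations of `B^K`. -/
def positiveRoots {r : ℕ} (A : Set (Submodule ℝ (Fin r → ℝ)))
    (R : Set (Module.Dual ℝ (Fin r → ℝ))) (K : Set (Fin r → ℝ)) :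
    Set (Module.Dual ℝ (Fin r → ℝ)) :=
  R ∩ (Submodule.span NNReal (simpleRoots A R K) : Set (Module.Dual ℝ (Fin r → ℝ)))

/-- Every element of `R` is an integer combination of `B^K`, for every chamber `K`. -/
def IsCrystallographic {r : ℕ} (A : Set (Submodule ℝ (Fin r → ℝ)))
    (R : Set (Module.Dual ℝ (Fin r → ℝ))) : Prop :=
  ∀ K ∈ chambers A,
    R ⊆ (Submodule.span ℤ (simpleRoots A R K) : Set (Module.Dual ℝ (Fin r → ℝ)))

/-- For every chamber `K`, every element of `R^K_+` outside `B^K` is a sum of two elements of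
`R^K_+`. -/
def IsAdditive {r : ℕ} (A : Set (Submodule ℝ (Fin r → ℝ)))
    (R : Set (Module.Dual ℝ (Fin r → ℝ))) : Prop :=
  ∀ K ∈ chambers A, ∀ α ∈ positiveRoots A R K \ simpleRoots A R K,
    ∃ β ∈ positiveRoots A R K, ∃ γ ∈ positiveRoots A R K, α = β + γ

end Arrangement

/-!
An additive root set is crystallographic by induction on the value of a positive root at a point of
the chamber.

Conversely, let `α` be positive on a chamber `K` of a crystallographic root set. Some chamber has
`α` in its base; choose one with as few hyperplanes as possible separating it from `K`. If its base
is positive on `K`, then the chamber is `K` and `α` is simple. Otherwise the base contains some `δ`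
negative on `K`; pass to the chamber closest to `K` among those at the codimension two face cut out
by `α` and `δ`. By minimality its base omits `α`. In the rank two system of roots vanishing on this
face, let `τ` complete `α` to an integral basis, positive on `K` and with the least value there. If
`α - τ` were not a root, then `α` and `τ` would form a base of some chamber, so that no root has
coefficients of opposite signs and `α` would be simple on the side of `K`. Hence `α - τ` is a root,
and it is positive on `K` by the choice of `τ`.
-/

namespace Arrangement

open Module

section Closure

variable {M N F : Type*} [AddMonoid M] {B : Set M} {ρ : M} {f : F}

theorem map_nonneg_of_mem_closure [AddMonoid N] [PartialOrder N] [AddLeftMono N] [FunLike F M N]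
    [AddMonoidHomClass F M N] (hf : ∀ b ∈ B, 0 ≤ f b) (hρ : ρ ∈ AddSubmonoid.closure B) :
    0 ≤ f ρ := by
  induction hρ using AddSubmonoid.closure_induction with
  | mem b hb => exact hf b hb
  | zero => exact (map_zero f).ge
  | add σ τ _ _ hσ hτ => exact map_add f σ τ ▸ add_nonneg hσ hτ

theorem mem_closure_of_map_eq_zero [AddMonoid N] [PartialOrder N] [AddLeftMono N]
    [AddRightMono N] [FunLike F M N] [AddMonoidHomClass F M N] (hf : ∀ b ∈ B, 0 ≤ f b)
    (hρ : ρ ∈ AddSubmonoid.closure B) (h0 : f ρ = 0) :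
    ρ ∈ AddSubmonoid.closure {b ∈ B | f b = 0} := by
  induction hρ using AddSubmonoid.closure_induction with
  | mem b hb => exact AddSubmonoid.subset_closure ⟨hb, h0⟩
  | zero => exact zero_mem _
  | add σ τ hσ hτ ihσ ihτ =>
    rw [map_add, add_eq_zero_iff_of_nonneg (map_nonneg_of_mem_closure hf hσ)
      (map_nonneg_of_mem_closure hf hτ)] at h0
    exact add_mem (ihσ h0.1) (ihτ h0.2)

theorem eq_zero_or_mem_or_two_le_map [Semiring N] [PartialOrder N] [IsOrderedRing N]
    [FunLike F M N] [AddMonoidHomClass F M N] (hf : ∀ b ∈ B, 1 ≤ f b)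
    (hρ : ρ ∈ AddSubmonoid.closure B) : ρ = 0 ∨ ρ ∈ B ∨ 2 ≤ f ρ := by
  have one_le : ∀ σ, σ ∈ B ∨ 2 ≤ f σ → 1 ≤ f σ := fun σ h ↦ h.elim (hf σ) one_le_two.trans
  induction hρ using AddSubmonoid.closure_induction with
  | mem b hb => exact .inr (.inl hb)
  | zero => exact .inl rfl
  | add σ τ _ _ ihσ ihτ =>
    rcases ihσ with rfl | hσ
    · rwa [zero_add]
    rcases ihτ with rfl | hτ
    · exact .inr (by rwa [add_zero])
    · refine .inr (.inr ?_)
      rw [map_add, ← one_add_one_eq_two]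
      exact add_le_add (one_le σ hσ) (one_le τ hτ)

end Closure

theorem exists_intCast_eq_apply_of_mem_span {K V : Type*} [CommRing K] [AddCommGroup V]
    [Module K V] {B : Set (Dual K V)} {ρ : Dual K V} {x : V} (hx : ∀ b ∈ B, ∃ n : ℤ, (n : K) = b x)
    (hρ : ρ ∈ Submodule.span ℤ B) : ∃ n : ℤ, (n : K) = ρ x := by
  have span_le_comap : Submodule.span ℤ B ≤
      (Submodule.span ℤ {(1 : K)}).comap ((Dual.eval K V x).restrictScalars ℤ) :=
    Submodule.span_le.2 fun b hb ↦ by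
      obtain ⟨n, hn⟩ := hx b hb
      exact Submodule.mem_span_singleton.2 ⟨n, by rw [zsmul_one]; exact hn⟩
  obtain ⟨n, hn⟩ := Submodule.mem_span_singleton.1 (span_le_comap hρ)
  exact ⟨n, by rwa [zsmul_one] at hn⟩

theorem exists_forall_apply_eq {ι K V : Type*} [Field K] [AddCommGroup V] [Module K V]
    [FiniteDimensional K V] {f : ι → Dual K V} (hf : LinearIndependent K f) (c : ι → K) :
    ∃ x, ∀ i, f i x = c i := by
  obtain ⟨g, hg⟩ := ((Basis.span hf).constr K c).exists_extend
  refine ⟨(evalEquiv K V).symm g, fun i ↦ ?_⟩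
  rw [apply_evalEquiv_symm_apply]
  calc g (f i) = (Basis.span hf).constr K c (Basis.span hf i) := by
        simp [← hg, Basis.span_apply]
    _ = c i := Basis.constr_basis ..

section IntegralSystem

variable {V : Type*} [AddCommGroup V] [Module ℝ V]

/-- `v` lies on none of the hyperplanes defined by the forms in `R`. -/
def IsRegular (R : Set (Dual ℝ V)) (v : V) : Prop :=
  ∀ ρ ∈ R, ρ v ≠ 0

/-- The localization of `R` at `x`: the forms of `R` whose hyperplane passes through `x`. -/
def localization (R : Set (Dual ℝ V)) (x : V) : Set (Dual ℝ V) :=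
  {ρ ∈ R | ρ x = 0}

/-- The forms of `R` whose hyperplane separates `v` from `w`, oriented towards `v`. -/
def separators (R : Set (Dual ℝ V)) (v w : V) : Set (Dual ℝ V) :=
  {ρ ∈ R | 0 < ρ v ∧ ρ w < 0}

/-- `B` is the integral base of `R` belonging to the chamber of `v`: it is linearly independent and
the forms of `R` that are positive at `v` are its combinations with natural number coefficients. -/
structure IsBase (R : Set (Dual ℝ V)) (v : V) (B : Set (Dual ℝ V)) : Prop where
  subset : B ⊆ R
  pos : ∀ β ∈ B, 0 < β v
  linearIndepOn : LinearIndepOn ℝ id B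
  mem_closure : ∀ ρ ∈ R, 0 < ρ v → ρ ∈ AddSubmonoid.closure B

/-- A finite, symmetric, reduced set of linear forms that has an integral base at every point off
its hyperplanes. This is what remains of a crystallographic root set when the hyperplanes are
forgotten, and unlike the latter it is inherited by localizations. -/
structure IsIntegralSystem (R : Set (Dual ℝ V)) : Prop where
  finite : R.Finite
  neg_mem : ∀ ρ ∈ R, -ρ ∈ R
  reduced : ∀ ρ ∈ R, ∀ c : ℝ, c • ρ ∈ R → c = 1 ∨ c = -1
  exists_isBase : ∀ v, IsRegular R v → ∃ B, IsBase R v B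

variable {R B B' C : Set (Dual ℝ V)} {u v v₀ w x : V} {α δ ρ τ : Dual ℝ V}

theorem IsRegular.neg_pos_of_not_pos (hv : IsRegular R v) (hρ : ρ ∈ R) (h : ¬ 0 < ρ v) :
    0 < (-ρ) v :=
  neg_pos.2 ((not_lt.1 h).lt_of_ne (hv ρ hρ))

theorem IsRegular.localize (hv : IsRegular R v) : IsRegular (localization R x) v :=
  fun ρ hρ ↦ hv ρ hρ.1

theorem exists_isRegular_near (hfin : R.Finite) (hneg : ∀ ρ ∈ R, -ρ ∈ R)
    (hu : IsRegular (localization R x) u) :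
    ∃ v, IsRegular R v ∧ (∀ ρ ∈ R, 0 < ρ x → 0 < ρ v) ∧
      ∀ ρ ∈ localization R x, 0 < ρ v ↔ 0 < ρ u := by
  have pos_near : ∀ᶠ t : ℝ in nhdsWithin 0 (Set.Ioi 0),
      ∀ ρ ∈ R, 0 < ρ x → 0 < ρ (x + t • u) := by
    rw [Filter.eventually_all_finite hfin]
    intro ρ _
    by_cases hx : 0 < ρ x
    · have hcont : Continuous fun t : ℝ ↦ ρ (x + t • u) := by
        simp only [map_add, map_smul]
        fun_prop
      have hlim := (hcont.tendsto 0).mono_left (nhdsWithin_le_nhds (s := Set.Ioi 0))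
      filter_upwards [hlim.eventually (lt_mem_nhds (by simpa using hx))] with t ht _ using ht
    · exact .of_forall fun t h ↦ absurd h hx
  obtain ⟨t, ht, ht0 : 0 < t⟩ := (pos_near.and self_mem_nhdsWithin).exists
  refine ⟨x + t • u, fun ρ hρ ↦ ?_, ht, fun ρ hρ ↦ by simp [hρ.2, ht0]⟩
  rcases lt_trichotomy (ρ x) 0 with h | h | h
  · exact (neg_pos.1 (ht (-ρ) (hneg ρ hρ) (neg_pos.2 h))).ne
  · simp [h, ht0.ne', hu ρ ⟨hρ, h⟩]
  · exact (ht ρ hρ h).ne'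

namespace IsBase

theorem exists_forall_apply_eq [FiniteDimensional ℝ V] (hB : IsBase R v B) (c : Dual ℝ V → ℝ) :
    ∃ x, ∀ b ∈ B, b x = c b := by
  obtain ⟨x, hx⟩ := Arrangement.exists_forall_apply_eq hB.linearIndepOn fun b ↦ c b
  exact ⟨x, fun b hb ↦ hx ⟨b, hb⟩⟩

theorem apply_nonneg (hB : IsBase R v B) (hx : ∀ b ∈ B, 0 ≤ b x) (hρ : ρ ∈ R) (hρv : 0 < ρ v) :
    0 ≤ ρ x :=
  map_nonneg_of_mem_closure (f := Dual.eval ℝ V x) hx (hB.mem_closure ρ hρ hρv)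

theorem mem_or_two_le_apply (hB : IsBase R v B) (hx : ∀ b ∈ B, 1 ≤ b x) (hρ : ρ ∈ R)
    (hρv : 0 < ρ v) : ρ ∈ B ∨ 2 ≤ ρ x := by
  rcases eq_zero_or_mem_or_two_le_map (f := Dual.eval ℝ V x) hx (hB.mem_closure ρ hρ hρv)
    with rfl | h
  · exact absurd hρv (lt_irrefl 0)
  · exact h

theorem subset_of_isBase [FiniteDimensional ℝ V] (hB : IsBase R v B) (hB' : IsBase R v B') :
    B ⊆ B' := by
  intro α hα
  obtain ⟨x, hx⟩ := hB.exists_forall_apply_eq fun _ ↦ 1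
  have one_le_apply : ∀ β ∈ B', 1 ≤ β x := fun β hβ ↦
    (hB.mem_or_two_le_apply (fun b hb ↦ (hx b hb).ge) (hB'.subset hβ) (hB'.pos β hβ)).elim
      (fun h ↦ (hx β h).ge) one_le_two.trans
  refine (hB'.mem_or_two_le_apply one_le_apply (hB.subset hα) (hB.pos α hα)).resolve_right ?_
  rw [hx α hα]
  norm_num

theorem pos_of_apply_pos (hB : IsBase R v B) (hneg : ∀ ρ ∈ R, -ρ ∈ R) (hv : IsRegular R v)
    (hx : ∀ b ∈ B, 0 ≤ b x) (hρ : ρ ∈ R) (hρx : 0 < ρ x) : 0 < ρ v :=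
  by_contra fun hρv ↦ hρx.not_ge <| neg_nonneg.1 <|
    hB.apply_nonneg hx (hneg ρ hρ) (hv.neg_pos_of_not_pos hρ hρv)

theorem of_pos (hB : IsBase R v B) (hneg : ∀ ρ ∈ R, -ρ ∈ R) (hv : IsRegular R v)
    (hw : ∀ b ∈ B, 0 < b w) : IsBase R w B where
  subset := hB.subset
  pos := hw
  linearIndepOn := hB.linearIndepOn
  mem_closure ρ hρ hρw := hB.mem_closure ρ hρ
    (hB.pos_of_apply_pos hneg hv (fun b hb ↦ (hw b hb).le) hρ hρw)

theorem subset_span_int (hB : IsBase R v B) (hneg : ∀ ρ ∈ R, -ρ ∈ R) (hv : IsRegular R v) :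
    R ⊆ Submodule.span ℤ B := by
  have pos_mem : ∀ ρ ∈ R, 0 < ρ v → ρ ∈ Submodule.span ℤ B := fun ρ hρ hρv ↦
    AddSubmonoid.closure_le (S := (Submodule.span ℤ B).toAddSubmonoid).2 Submodule.subset_span
      (hB.mem_closure ρ hρ hρv)
  intro ρ hρ
  by_cases hρv : 0 < ρ v
  · exact pos_mem ρ hρ hρv
  · exact neg_mem_iff.1 (pos_mem (-ρ) (hneg ρ hρ) (hv.neg_pos_of_not_pos hρ hρv))

theorem apply_nonpos_of_eq_zsmul_sub_zsmul [FiniteDimensional ℝ V] (hB : IsBase R v B)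
    (hα : α ∈ B) (hτ : τ ∈ B) (hne : α ≠ τ) {a b : ℤ} (hb : 0 < b) (hab : a • α - b • τ ∈ R) :
    (a • α - b • τ) v ≤ 0 := by
  classical
  by_contra! hpos
  obtain ⟨p, hp⟩ := hB.exists_forall_apply_eq fun β ↦ if β = τ then 1 else 0
  have hp_nonneg : ∀ β ∈ B, 0 ≤ β p := fun β hβ ↦ by
    rw [hp β hβ]
    split_ifs <;> norm_num
  have hab_nonneg := hB.apply_nonneg hp_nonneg hab hpos
  have hab_eq : (a • α - b • τ) p = -b := by simp [hp α hα, hp τ hτ, hne]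
  rw [hab_eq, Left.nonneg_neg_iff] at hab_nonneg
  exact hab_nonneg.not_gt (mod_cast hb)

theorem zsmul_sub_zsmul_notMem [FiniteDimensional ℝ V] (hB : IsBase R v B)
    (hneg : ∀ ρ ∈ R, -ρ ∈ R) (hv : IsRegular R v) (hα : α ∈ B) (hτ : τ ∈ B) (hne : α ≠ τ)
    {a b : ℤ} (ha : 0 < a) (hb : 0 < b) : a • α - b • τ ∉ R := by
  intro hab
  have hba : b • τ - a • α ∈ R := neg_sub (a • α) (b • τ) ▸ hneg _ hab
  have hpos := hv.neg_pos_of_not_pos hab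
    (hB.apply_nonpos_of_eq_zsmul_sub_zsmul hα hτ hne hb hab).not_gt
  rw [neg_sub] at hpos
  exact hpos.not_ge (hB.apply_nonpos_of_eq_zsmul_sub_zsmul hτ hα hne.symm ha hba)

theorem apply_nonneg_of_near (hB : IsBase R v B) (hneg : ∀ ρ ∈ R, -ρ ∈ R)
    (hxv : ∀ ρ ∈ R, 0 < ρ x → 0 < ρ v) (hb : α ∈ B) : 0 ≤ α x := by
  by_contra! h
  have hneg_pos := hxv (-α) (hneg α (hB.subset hb)) (neg_pos.2 h)
  exact lt_asymm (hB.pos α hb) (neg_pos.1 hneg_pos)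

theorem localize (hB : IsBase R v B) (hx : ∀ b ∈ B, 0 ≤ b x)
    (huv : ∀ ρ ∈ localization R x, 0 < ρ v ↔ 0 < ρ u) :
    IsBase (localization R x) u {b ∈ B | b x = 0} where
  subset _ hb := ⟨hB.subset hb.1, hb.2⟩
  pos _ hb := (huv _ ⟨hB.subset hb.1, hb.2⟩).1 (hB.pos _ hb.1)
  linearIndepOn := hB.linearIndepOn.mono (Set.sep_subset B _)
  mem_closure ρ hρ hρu := mem_closure_of_map_eq_zero (f := Dual.eval ℝ V x) hx
    (hB.mem_closure ρ hρ.1 ((huv ρ hρ).2 hρu)) hρ.2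

end IsBase

namespace IsIntegralSystem

theorem zero_notMem (hR : IsIntegralSystem R) : (0 : Dual ℝ V) ∉ R := fun h ↦ by
  have := hR.reduced 0 h 2 (by rwa [smul_zero])
  norm_num at this

theorem localize (hR : IsIntegralSystem R) (x : V) :
    IsIntegralSystem (localization R x) where
  finite := hR.finite.subset (Set.sep_subset R _)
  neg_mem ρ hρ := ⟨hR.neg_mem ρ hρ.1, neg_eq_zero.2 hρ.2⟩
  reduced ρ hρ c hc := hR.reduced ρ hρ.1 c hc.1
  exists_isBase u hu := by
    obtain ⟨v, hv, hxv, hvu⟩ := exists_isRegular_near hR.finite hR.neg_mem hu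
    obtain ⟨B, hB⟩ := hR.exists_isBase v hv
    exact ⟨_, hB.localize (fun b hb ↦ hB.apply_nonneg_of_near hR.neg_mem hxv hb) hvu⟩

theorem exists_localization_subset_pair (hR : IsIntegralSystem R) (hα : α ∈ R) :
    ∃ x, α x = 0 ∧ ∀ ρ ∈ localization R x, ρ = α ∨ ρ = -α := by
  have : Finite {ρ // ρ ∈ R ∧ ρ ≠ α ∧ ρ ≠ -α} := (hR.finite.subset fun ρ h ↦ h.1).to_subtype
  obtain ⟨x, hx, hxρ⟩ := Module.Dual.exists_forall_mem_ne_zero_of_forall_exists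
    (LinearMap.ker α) (fun ρ : {ρ // ρ ∈ R ∧ ρ ≠ α ∧ ρ ≠ -α} ↦ (ρ : Dual ℝ V)) <| by
      rintro ⟨ρ, hρ, hρα, hρα'⟩
      by_contra! hker
      have hspan : ρ ∈ Submodule.span ℝ (Set.range fun _ : Unit ↦ α) :=
        mem_span_of_iInf_ker_le_ker ((iInf_const (ι := Unit)).trans_le hker)
      rw [Set.range_const, Submodule.mem_span_singleton] at hspan
      obtain ⟨c, rfl⟩ := hspan
      rcases hR.reduced α hα c hρ with rfl | rfl
      · exact hρα (one_smul ℝ α)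
      · exact hρα' (neg_one_smul ℝ α)
  refine ⟨x, hx, fun ρ hρ ↦ ?_⟩
  by_contra! h
  exact hxρ ⟨ρ, hρ.1, h⟩ hρ.2

theorem exists_isBase_mem (hR : IsIntegralSystem R) (hα : α ∈ R) :
    ∃ v, IsRegular R v ∧ ∃ B, IsBase R v B ∧ α ∈ B := by
  obtain ⟨x, hαx, hx⟩ := hR.exists_localization_subset_pair hα
  obtain ⟨u, hu⟩ : ∃ u, α u = 1 :=
    LinearMap.surjective_iff_ne_zero.2 (fun h ↦ hR.zero_notMem (h ▸ hα)) 1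
  have hux : IsRegular (localization R x) u := fun ρ hρ ↦ by
    rcases hx ρ hρ with rfl | rfl <;> simp [hu]
  obtain ⟨v, hv, hxv, hvu⟩ := exists_isRegular_near hR.finite hR.neg_mem hux
  obtain ⟨B, hB⟩ := hR.exists_isBase v hv
  have hBx := hB.localize (fun b hb ↦ hB.apply_nonneg_of_near hR.neg_mem hxv hb) hvu
  have subset_singleton : {b ∈ B | b x = 0} ⊆ {α} := fun b hb ↦
    (hx b (hBx.subset hb)).resolve_right fun h ↦ by
      have := hBx.pos b hb
      norm_num [h, hu] at this
  refine ⟨v, hv, B, hB, ?_⟩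
  rcases Set.subset_singleton_iff_eq.1 subset_singleton with h | h
  · have := hBx.mem_closure α ⟨hα, hαx⟩ (hu ▸ one_pos)
    rw [h, AddSubmonoid.closure_empty, AddSubmonoid.mem_bot] at this
    exact absurd (this ▸ hα) hR.zero_notMem
  · exact (h.symm ▸ Set.mem_singleton α : α ∈ {b ∈ B | b x = 0}).1

theorem eq_one_or_neg_one_of_zsmul_mem [FiniteDimensional ℝ V] (hR : IsIntegralSystem R)
    {σ : Dual ℝ V} {m : ℤ} (hσ : σ ∈ Submodule.span ℤ R) (hm : m • σ ∈ R) : m = 1 ∨ m = -1 := by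
  obtain ⟨v, hv, B, hB, hmB⟩ := hR.exists_isBase_mem hm
  obtain ⟨x, hx⟩ := hB.exists_forall_apply_eq fun _ ↦ 1
  have hσB : σ ∈ Submodule.span ℤ B := Submodule.span_le.2 (hB.subset_span_int hR.neg_mem hv) hσ
  obtain ⟨n, hn⟩ : ∃ n : ℤ, (n : ℝ) = σ x :=
    exists_intCast_eq_apply_of_mem_span (fun b hb ↦ ⟨1, by rw [hx b hb, Int.cast_one]⟩) hσB
  have hmn : m * n = 1 := by
    have := hx _ hmB
    rw [LinearMap.smul_apply, ← hn, zsmul_eq_mul] at this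
    exact_mod_cast this
  exact Int.eq_one_or_neg_one_of_mul_eq_one hmn

end IsIntegralSystem

/-- `α` and `τ` form an `ℝ`-independent pair of elements of `S` whose integer combinations comprise
`S`; in particular `S` has rank two. -/
structure IsIntegralPair (S : Set (Dual ℝ V)) (α τ : Dual ℝ V) : Prop where
  left_mem : α ∈ S
  right_mem : τ ∈ S
  linearIndependent : LinearIndependent ℝ ![α, τ]
  subset_span : S ⊆ Submodule.span ℤ {α, τ}

namespace IsIntegralPair

variable {S : Set (Dual ℝ V)}

theorem exists_int_add (h : IsIntegralPair S α τ) (hρ : ρ ∈ S) :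
    ∃ i j : ℤ, ρ = i • α + j • τ := by
  obtain ⟨i, j, hij⟩ := Submodule.mem_span_pair.1 (h.subset_span hρ)
  exact ⟨i, j, hij.symm⟩

theorem exists_apply_eq [FiniteDimensional ℝ V] (h : IsIntegralPair S α τ) (a b : ℝ) :
    ∃ x, α x = a ∧ τ x = b := by
  obtain ⟨x, hx⟩ := exists_forall_apply_eq h.linearIndependent ![a, b]
  exact ⟨x, hx 0, hx 1⟩

theorem neg_right (h : IsIntegralPair S α τ) (hτ : -τ ∈ S) : IsIntegralPair S α (-τ) where
  left_mem := h.left_mem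
  right_mem := hτ
  linearIndependent := LinearIndependent.pair_neg_right_iff.2 h.linearIndependent
  subset_span _ hρ := by
    obtain ⟨i, j, rfl⟩ := h.exists_int_add hρ
    exact Submodule.mem_span_pair.2 ⟨i, -j, by rw [neg_smul_neg]⟩

theorem sub_right (h : IsIntegralPair S α τ) (hτ : τ - α ∈ S) : IsIntegralPair S α (τ - α) where
  left_mem := h.left_mem
  right_mem := hτ
  linearIndependent := by
    have := (LinearIndependent.pair_add_smul_right_iff (c := (-1 : ℝ))).2 h.linearIndependent
    rwa [neg_one_smul, neg_add_eq_sub] at this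
  subset_span _ hρ := by
    obtain ⟨i, j, rfl⟩ := h.exists_int_add hρ
    exact Submodule.mem_span_pair.2 ⟨i + j, j, by module⟩

theorem mem_base (h : IsIntegralPair S α τ) (hB : IsBase S u B) (hα : α u = 1) (hτ : τ u = 1) :
    α ∈ B ∧ τ ∈ B := by
  have one_le_apply : ∀ b ∈ B, 1 ≤ b u := by
    intro b hb
    have hbu := hB.pos b hb
    obtain ⟨i, j, rfl⟩ := h.exists_int_add (hB.subset hb)
    simp only [LinearMap.add_apply, LinearMap.smul_apply, hα, hτ, zsmul_one] at hbu ⊢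
    exact_mod_cast hbu
  have mem_of_apply_eq_one : ∀ ρ ∈ S, ρ u = 1 → ρ ∈ B := fun ρ hρ hρu ↦
    (hB.mem_or_two_le_apply one_le_apply hρ (hρu ▸ one_pos)).resolve_right (by norm_num [hρu])
  exact ⟨mem_of_apply_eq_one α h.left_mem hα, mem_of_apply_eq_one τ h.right_mem hτ⟩

theorem eq_or_eq_neg_of_apply_eq_zero (h : IsIntegralPair S α τ) (hS : IsIntegralSystem S)
    (hα : α x = 0) (hτ : τ x = 1) (hρ : ρ ∈ S) (hρx : ρ x = 0) : ρ = α ∨ ρ = -α := by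
  obtain ⟨i, j, rfl⟩ := h.exists_int_add hρ
  obtain rfl : j = 0 := by simpa [hα, hτ] using hρx
  rw [zero_smul, add_zero, ← Int.cast_smul_eq_zsmul ℝ] at hρ ⊢
  rcases hS.reduced α h.left_mem i hρ with hi | hi
  · exact .inl (by rw [hi, one_smul])
  · exact .inr (by rw [hi, neg_one_smul])

theorem exists_isIntegralPair_apply_pos_minimal (h : IsIntegralPair S α δ)
    (hS : IsIntegralSystem S) (hv : IsRegular S v) :
    ∃ τ, IsIntegralPair S α τ ∧ 0 < τ v ∧ ∀ σ, IsIntegralPair S α σ → 0 < σ v → τ v ≤ σ v := by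
  have hfin : {τ | IsIntegralPair S α τ ∧ 0 < τ v}.Finite :=
    hS.finite.subset fun τ hτ ↦ hτ.1.right_mem
  have hne : {τ | IsIntegralPair S α τ ∧ 0 < τ v}.Nonempty := by
    by_cases hδ : 0 < δ v
    · exact ⟨δ, h, hδ⟩
    · exact ⟨-δ, h.neg_right (hS.neg_mem δ h.right_mem), hv.neg_pos_of_not_pos h.right_mem hδ⟩
  obtain ⟨τ, ⟨hτ, hτv⟩, hmin⟩ := Set.exists_min_image _ (fun τ ↦ τ v) hfin hne
  exact ⟨τ, hτ, hτv, fun σ hσ hσv ↦ hmin σ ⟨hσ, hσv⟩⟩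

variable [FiniteDimensional ℝ V]

theorem isRegular_of_sub_notMem (h : IsIntegralPair S α τ) (hS : IsIntegralSystem S)
    (hsub : α - τ ∉ S) (hα : α u = 1) (hτ : τ u = 1) : IsRegular S u := by
  intro ρ hρ hρu
  obtain ⟨i, j, rfl⟩ := h.exists_int_add hρ
  obtain rfl : j = -i := by
    simp only [LinearMap.add_apply, LinearMap.smul_apply, hα, hτ, zsmul_one] at hρu
    exact_mod_cast eq_neg_of_add_eq_zero_right hρu
  have hρ_eq : i • α + -i • τ = i • (α - τ) := by module
  have hmem : α - τ ∈ Submodule.span ℤ S :=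
    sub_mem (Submodule.subset_span h.left_mem) (Submodule.subset_span h.right_mem)
  rw [hρ_eq] at hρ
  rcases hS.eq_one_or_neg_one_of_zsmul_mem hmem hρ with rfl | rfl
  · exact hsub (by simpa using hρ)
  · exact hsub (by simpa using hS.neg_mem _ hρ)

/-- If `α - τ` is missing, then `α` and `τ` lie in a common base, which leaves no room for elements
with coefficients of opposite signs. -/
theorem sub_mem_of_zsmul_sub_zsmul_mem (h : IsIntegralPair S α τ) (hS : IsIntegralSystem S)
    {a b : ℤ} (ha : 0 < a) (hb : 0 < b) (hab : a • α - b • τ ∈ S) : α - τ ∈ S := by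
  by_contra hsub
  obtain ⟨u, hαu, hτu⟩ := h.exists_apply_eq 1 1
  have hu := h.isRegular_of_sub_notMem hS hsub hαu hτu
  obtain ⟨B, hB⟩ := hS.exists_isBase u hu
  obtain ⟨hα, hτ⟩ := h.mem_base hB hαu hτu
  have hne : α ≠ τ := h.linearIndependent.injective.ne (a₁ := 0) (a₂ := 1) (by decide)
  exact hB.zsmul_sub_zsmul_notMem hS.neg_mem hu hα hτ hne ha hb hab

/-- Some element of the base has a negative `τ`-coefficient, since otherwise `α` would lie in the
base. -/
theorem sub_mem_of_notMem_base (h : IsIntegralPair S α τ) (hS : IsIntegralSystem S)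
    (hB : IsBase S v B) (hαv : 0 < α v) (hτv : 0 < τ v) (hαB : α ∉ B) : α - τ ∈ S := by
  obtain ⟨p, hαp, hτp⟩ := h.exists_apply_eq 0 1
  obtain ⟨b, hb, hbp⟩ : ∃ b ∈ B, b p < 0 := by
    by_contra! hp
    have hbase := hB.localize hp (u := v) fun _ _ ↦ Iff.rfl
    have hempty : {b ∈ B | b p = 0} = ∅ := by
      refine Set.eq_empty_of_forall_notMem fun b hb ↦ ?_
      rcases h.eq_or_eq_neg_of_apply_eq_zero hS hαp hτp (hB.subset hb.1) hb.2 with rfl | rfl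
      · exact hαB hb.1
      · exact lt_asymm hαv (neg_pos.1 (hB.pos _ hb.1))
    have hα := hbase.mem_closure α ⟨h.left_mem, hαp⟩ hαv
    rw [hempty, AddSubmonoid.closure_empty, AddSubmonoid.mem_bot] at hα
    exact hS.zero_notMem (hα ▸ h.left_mem)
  obtain ⟨i, j, rfl⟩ := h.exists_int_add (hB.subset hb)
  have hj : j < 0 := by simpa [hαp, hτp] using hbp
  have hi : 0 < i := by
    by_contra! hi
    refine (hB.pos _ hb).not_ge ?_
    simp only [LinearMap.add_apply, LinearMap.smul_apply]
    exact add_nonpos (smul_nonpos_of_nonpos_of_nonneg hi hαv.le)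
      (smul_nonpos_of_nonpos_of_nonneg hj.le hτv.le)
  refine h.sub_mem_of_zsmul_sub_zsmul_mem hS hi (neg_pos.2 hj) ?_
  rw [neg_smul, sub_neg_eq_add]
  exact hB.subset hb

theorem exists_eq_add (h : IsIntegralPair S α δ) (hS : IsIntegralSystem S) (hv : IsRegular S v)
    (hB : IsBase S v B) (hαv : 0 < α v) (hαB : α ∉ B) :
    ∃ β ∈ S, ∃ γ ∈ S, 0 < β v ∧ 0 < γ v ∧ α = β + γ := by
  obtain ⟨τ, hτ, hτv, hmin⟩ := h.exists_isIntegralPair_apply_pos_minimal hS hv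
  have hsub := hτ.sub_mem_of_notMem_base hS hB hαv hτv hαB
  refine ⟨τ, hτ.right_mem, α - τ, hsub, hτv, ?_, (add_sub_cancel τ α).symm⟩
  by_contra hneg
  have hpos := hv.neg_pos_of_not_pos hsub hneg
  have hsub' := hS.neg_mem _ hsub
  rw [neg_sub] at hpos hsub'
  have := hmin (τ - α) (hτ.sub_right hsub') hpos
  rw [LinearMap.sub_apply] at this
  linarith

end IsIntegralPair

theorem IsBase.isIntegralPair (hB : IsBase R v {α, δ}) (hneg : ∀ ρ ∈ R, -ρ ∈ R)
    (hv : IsRegular R v) (hne : α ≠ δ) : IsIntegralPair R α δ where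
  left_mem := hB.subset (by simp)
  right_mem := hB.subset (by simp)
  linearIndependent :=
    LinearIndependent.pair_iff.2 ((LinearIndepOn.pair_iff id hne).1 hB.linearIndepOn)
  subset_span := hB.subset_span_int hneg hv

theorem IsBase.exists_isBase_localization_of_subset [FiniteDimensional ℝ V] (hB : IsBase R v B)
    (hC : C ⊆ B) : ∃ x, (∀ b ∈ B, 0 ≤ b x) ∧ IsBase (localization R x) v C := by
  classical
  obtain ⟨x, hx⟩ := hB.exists_forall_apply_eq fun b ↦ if b ∈ C then 0 else 1
  have hx_nonneg : ∀ b ∈ B, 0 ≤ b x := fun b hb ↦ by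
    rw [hx b hb]
    split_ifs <;> norm_num
  have hC_eq : {b ∈ B | b x = 0} = C := by
    ext b
    refine ⟨fun hb ↦ ?_, fun hb ↦ ⟨hC hb, by rw [hx b (hC hb), if_pos hb]⟩⟩
    have hbx := hb.2
    simpa [hx b hb.1] using hbx
  exact ⟨x, hx_nonneg, hC_eq ▸ hB.localize hx_nonneg fun _ _ ↦ Iff.rfl⟩

theorem separators_ssubset (hneg : ∀ ρ ∈ R, -ρ ∈ R) (hxv : ∀ ρ ∈ R, 0 < ρ x → 0 < ρ v)
    (hxw : ∀ ρ ∈ R, 0 < ρ x → 0 < ρ w)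
    (hwv₀ : ∀ ρ ∈ localization R x, 0 < ρ w ↔ 0 < ρ v₀) (hδ : δ ∈ localization R x)
    (hδv : 0 < δ v) (hδv₀ : δ v₀ < 0) : separators R v₀ w ⊂ separators R v₀ v := by
  have hδ_mem : -δ ∈ separators R v₀ v := ⟨hneg δ hδ.1, neg_pos.2 hδv₀, neg_neg_iff_pos.2 hδv⟩
  refine ⟨fun ρ hρ ↦ ⟨hρ.1, hρ.2.1, ?_⟩, fun hsub ↦ ?_⟩
  · rcases lt_trichotomy (ρ x) 0 with h | h | h
    · exact neg_pos.1 (hxv (-ρ) (hneg ρ hρ.1) (neg_pos.2 h))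
    · exact absurd ((hwv₀ ρ ⟨hρ.1, h⟩).2 hρ.2.1) (lt_asymm hρ.2.2)
    · exact absurd (hxw ρ hρ.1 h) (lt_asymm hρ.2.2)
  · exact lt_asymm ((hwv₀ δ hδ).1 (neg_neg_iff_pos.1 (hsub hδ_mem).2.2)) hδv₀

namespace IsIntegralSystem

variable [FiniteDimensional ℝ V]

/-- Localize at the codimension two face of the chamber of `v` cut out by `α` and `δ`, and move to
the chamber at that face that is closest to `v₀`. -/
theorem exists_isBase_ssubset_separators_or_exists_eq_add (hR : IsIntegralSystem R)
    (hv₀ : IsRegular R v₀) (hv : IsRegular R v) (hB : IsBase R v B) (hα : α ∈ B) (hδ : δ ∈ B)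
    (hαv₀ : 0 < α v₀) (hδv₀ : δ v₀ < 0) :
    (∃ w B', IsRegular R w ∧ IsBase R w B' ∧ α ∈ B' ∧ separators R v₀ w ⊂ separators R v₀ v) ∨
      ∃ β ∈ R, ∃ γ ∈ R, 0 < β v₀ ∧ 0 < γ v₀ ∧ α = β + γ := by
  obtain ⟨x, hx, hpair⟩ := hB.exists_isBase_localization_of_subset (Set.pair_subset hα hδ)
  have hRx := hR.localize x
  have hne : α ≠ δ := by
    rintro rfl
    exact lt_asymm hαv₀ hδv₀
  have hαδ := hpair.isIntegralPair hRx.neg_mem hv.localize hne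
  obtain ⟨w, hw, hxw, hwv₀⟩ :=
    exists_isRegular_near hR.finite hR.neg_mem (hv₀.localize (x := x))
  obtain ⟨B', hB'⟩ := hR.exists_isBase w hw
  by_cases hαB' : α ∈ B'
  · refine .inl ⟨w, B', hw, hB', hαB', ?_⟩
    exact separators_ssubset hR.neg_mem (fun ρ ↦ hB.pos_of_apply_pos hR.neg_mem hv hx) hxw hwv₀
      hαδ.right_mem (hB.pos δ hδ) hδv₀
  · have hB'x := hB'.localize (fun b hb ↦ hB'.apply_nonneg_of_near hR.neg_mem hxw hb) hwv₀
    obtain ⟨β, hβ, γ, hγ, hsum⟩ :=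
      hαδ.exists_eq_add hRx hv₀.localize hB'x hαv₀ fun h ↦ hαB' h.1
    exact .inr ⟨β, hβ.1, γ, hγ.1, hsum⟩

theorem mem_base_or_exists_eq_add (hR : IsIntegralSystem R) (hv₀ : IsRegular R v₀)
    {B₀ : Set (Dual ℝ V)} (hB₀ : IsBase R v₀ B₀) (hα : α ∈ R) (hαv₀ : 0 < α v₀) :
    α ∈ B₀ ∨ ∃ β ∈ R, ∃ γ ∈ R, 0 < β v₀ ∧ 0 < γ v₀ ∧ α = β + γ := by
  obtain ⟨v, hv, B, hB, hαB⟩ := hR.exists_isBase_mem hα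
  induction h : (separators R v₀ v).ncard using Nat.strong_induction_on generalizing v B with
  | h n ih =>
  by_cases hpos : ∀ b ∈ B, 0 < b v₀
  · exact .inl ((hB.of_pos hR.neg_mem hv hpos).subset_of_isBase hB₀ hαB)
  · push Not at hpos
    obtain ⟨δ, hδ, hδv₀⟩ := hpos
    rcases hR.exists_isBase_ssubset_separators_or_exists_eq_add hv₀ hv hB hαB hδ hαv₀
      (hδv₀.lt_of_ne (hv₀ δ (hB.subset hδ))) with ⟨w, B', hw, hB', hαB', hlt⟩ | hsum
    · exact ih _ (h ▸ Set.ncard_lt_ncard hlt (hR.finite.subset (Set.sep_subset R _))) w hw B' hB'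
        hαB' rfl
    · exact .inr hsum

end IsIntegralSystem

end IntegralSystem

section SimplicialCone

variable {ι V : Type*} [AddCommGroup V] [Module ℝ V] {b : Basis ι ℝ V} {ρ : Dual ℝ V} {x : V}

/-- The open simplicial cone spanned by the basis `b`, described by the coordinate forms. -/
def simplicialCone (b : Basis ι ℝ V) : Set V :=
  {u | ∀ i, 0 < b.coord i u}

theorem simplicialCone_eq_of_coord_eq_smul {e : Basis ι ℝ V} {c : ι → ℝ} (hc : ∀ i, 0 < c i)
    (he : ∀ i, e.coord i = c i • b.coord i) : simplicialCone e = simplicialCone b := by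
  ext u
  exact forall_congr' fun i ↦ by
    rw [he, LinearMap.smul_apply, smul_eq_mul, mul_pos_iff_of_pos_left (hc i)]

theorem IsOpenSimplicialCone.exists_eq_simplicialCone {r : ℕ} {K : Set (Fin r → ℝ)}
    (hK : IsOpenSimplicialCone K) : ∃ b : Basis (Fin r) ℝ (Fin r → ℝ), K = simplicialCone b := by
  obtain ⟨b, rfl⟩ := hK
  refine ⟨b, Set.ext fun u ↦ ⟨?_, fun hu ↦ ⟨fun i ↦ b.coord i u, hu, (b.sum_repr u).symm⟩⟩⟩
  rintro ⟨a, ha, rfl⟩ i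
  rw [Basis.coord_apply, b.repr_sum_self]
  exact ha i

variable [Finite ι]

theorem apply_basis_eq_zero_or_coord_eq_zero (hρ : ∀ i, 0 ≤ ρ (b i)) (hx : ∀ i, 0 ≤ b.coord i x)
    (hρx : ρ x = 0) (i : ι) : ρ (b i) = 0 ∨ b.coord i x = 0 := by
  cases nonempty_fintype ι
  rw [← b.sum_dual_apply_smul_coord ρ] at hρx
  simp only [LinearMap.sum_apply, LinearMap.smul_apply, smul_eq_mul] at hρx
  rw [Finset.sum_eq_zero_iff_of_nonneg fun j _ ↦ mul_nonneg (hρ j) (hx j)] at hρx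
  exact mul_eq_zero.1 (hρx i (Finset.mem_univ i))

variable [TopologicalSpace V] [IsTopologicalAddGroup V] [ContinuousSMul ℝ V] [T2Space V]

theorem closure_simplicialCone (b : Basis ι ℝ V) :
    closure (simplicialCone b) = {u | ∀ i, 0 ≤ b.coord i u} := by
  cases nonempty_fintype ι
  have hcone : simplicialCone b =
      b.equivFunL.toHomeomorph ⁻¹' Set.univ.pi fun _ ↦ Set.Ioi (0 : ℝ) := by
    ext u
    simp [simplicialCone]
  rw [hcone, ← Homeomorph.preimage_closure, closure_pi_set]
  ext u
  simp [Pi.le_def]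

theorem basis_mem_closure_simplicialCone (b : Basis ι ℝ V) (i : ι) :
    b i ∈ closure (simplicialCone b) := by
  classical
  rw [closure_simplicialCone]
  intro j
  rw [Basis.coord_apply, b.repr_self_apply]
  split_ifs <;> norm_num

theorem apply_basis_nonneg (hρ : ∀ u ∈ simplicialCone b, 0 ≤ ρ u) (i : ι) : 0 ≤ ρ (b i) := by
  have := b.finiteDimensional_of_finite
  have hclosed : IsClosed {u | 0 ≤ ρ u} :=
    isClosed_le continuous_const ρ.continuous_of_finiteDimensional
  exact closure_minimal hρ hclosed (basis_mem_closure_simplicialCone b i)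

theorem span_ker_coord_inter_closure_simplicialCone (b : Basis ι ℝ V) (i : ι) :
    Submodule.span ℝ ((LinearMap.ker (b.coord i) : Set V) ∩ closure (simplicialCone b)) =
      LinearMap.ker (b.coord i) := by
  cases nonempty_fintype ι
  refine le_antisymm (Submodule.span_le.2 Set.inter_subset_left) fun u hu ↦ ?_
  rw [← b.sum_repr u]
  refine Submodule.sum_mem _ fun j _ ↦ ?_
  rcases eq_or_ne j i with rfl | hj
  · have hu0 : b.repr u j = 0 := hu
    rw [hu0, zero_smul]
    exact Submodule.zero_mem _
  · refine Submodule.smul_mem _ _ (Submodule.subset_span ⟨?_, basis_mem_closure_simplicialCone b j⟩)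
    simp [hj]

theorem span_ker_inter_closure_simplicialCone_le (hρ : ∀ u ∈ simplicialCone b, 0 ≤ ρ u) {i : ι}
    (hi : ρ (b i) ≠ 0) :
    Submodule.span ℝ ((LinearMap.ker ρ : Set V) ∩ closure (simplicialCone b)) ≤
      LinearMap.ker (b.coord i) := by
  rw [closure_simplicialCone]
  exact Submodule.span_le.2 fun u hu ↦
    (apply_basis_eq_zero_or_coord_eq_zero (apply_basis_nonneg hρ) hu.2 hu.1 i).resolve_left hi

end SimplicialCone

section RootSet

variable {r : ℕ} {A : Set (Submodule ℝ (Fin r → ℝ))} {R : Set (Dual ℝ (Fin r → ℝ))}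
  {v : Fin r → ℝ} {ρ σ : Dual ℝ (Fin r → ℝ)} {e : Basis (Fin r) ℝ (Fin r → ℝ)}

namespace IsRootSet

theorem ker_mem (hR : IsRootSet A R) (hρ : ρ ∈ R) : LinearMap.ker ρ ∈ A := by
  obtain ⟨x, hx, rfl⟩ := hR
  obtain ⟨H, hH, rfl | rfl⟩ := hρ
  · rwa [hx H hH]
  · rwa [LinearMap.ker_neg, hx H hH]

theorem exists_ker_eq (hR : IsRootSet A R) {H : Submodule ℝ (Fin r → ℝ)} (hH : H ∈ A) :
    ∃ ρ ∈ R, LinearMap.ker ρ = H := by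
  obtain ⟨x, hx, rfl⟩ := hR
  exact ⟨x H, ⟨H, hH, .inl rfl⟩, hx H hH⟩

theorem neg_mem (hR : IsRootSet A R) (ρ : Dual ℝ (Fin r → ℝ)) (hρ : ρ ∈ R) : -ρ ∈ R := by
  obtain ⟨x, _, rfl⟩ := hR
  obtain ⟨H, hH, rfl | rfl⟩ := hρ
  · exact ⟨H, hH, .inr rfl⟩
  · exact ⟨H, hH, .inl (neg_neg _)⟩

theorem finite (hR : IsRootSet A R) (hA : A.Finite) : R.Finite := by
  obtain ⟨x, _, rfl⟩ := hR
  refine ((hA.image x).union (hA.image fun H ↦ -x H)).subset ?_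
  rintro α ⟨H, hH, rfl | rfl⟩
  · exact .inl ⟨H, hH, rfl⟩
  · exact .inr ⟨H, hH, rfl⟩

theorem eq_or_eq_neg_of_ker_eq (hR : IsRootSet A R) (hρ : ρ ∈ R) (hσ : σ ∈ R)
    (h : LinearMap.ker σ = LinearMap.ker ρ) : σ = ρ ∨ σ = -ρ := by
  obtain ⟨x, hx, rfl⟩ := hR
  obtain ⟨H, hH, hρ⟩ := hρ
  obtain ⟨H', hH', hσ⟩ := hσ
  have hkerρ : LinearMap.ker ρ = H := by rcases hρ with rfl | rfl <;> simp [hx H hH]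
  have hkerσ : LinearMap.ker σ = H' := by rcases hσ with rfl | rfl <;> simp [hx H' hH']
  obtain rfl : H = H' := by rw [← hkerρ, ← hkerσ, h]
  rcases hρ with rfl | rfl <;> rcases hσ with rfl | rfl <;> simp

theorem zero_notMem (hR : IsRootSet A R) (hA : IsSimplicial A) :
    (0 : Dual ℝ (Fin r → ℝ)) ∉ R := by
  intro h
  have := hA.hyperplane _ (hR.ker_mem h)
  rw [LinearMap.ker_zero, finrank_top, finrank_fin_fun] at this
  exact Nat.succ_ne_self r this

theorem reduced (hR : IsRootSet A R) (hA : IsSimplicial A) (hρ : ρ ∈ R) {c : ℝ}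
    (hc : c • ρ ∈ R) : c = 1 ∨ c = -1 := by
  have hρ0 : ρ ≠ 0 := fun h ↦ hR.zero_notMem hA (h ▸ hρ)
  have hc0 : c ≠ 0 := by
    rintro rfl
    exact hR.zero_notMem hA (zero_smul ℝ ρ ▸ hc)
  rcases hR.eq_or_eq_neg_of_ker_eq hρ hc (LinearMap.ker_smul ρ c hc0) with h | h
  · exact .inl (smul_left_injective ℝ hρ0 (by simpa using h))
  · exact .inr (smul_left_injective ℝ hρ0 (by simpa using h))

theorem mem_complement_iff (hR : IsRootSet A R) : v ∈ complement A ↔ IsRegular R v := by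
  simp only [complement, Set.mem_compl_iff, Set.mem_iUnion, not_exists, SetLike.mem_coe]
  constructor
  · exact fun h ρ hρ h0 ↦ h _ (hR.ker_mem hρ) h0
  · intro h H hH hv
    obtain ⟨ρ, hρ, rfl⟩ := hR.exists_ker_eq hH
    exact h ρ hρ hv

theorem apply_pos_of_mem_connectedComponentIn (hR : IsRootSet A R) {w : Fin r → ℝ}
    (hw : w ∈ connectedComponentIn (complement A) v) (hρ : ρ ∈ R) (hρv : 0 < ρ v) : 0 < ρ w := by
  by_contra h
  have hv : v ∈ connectedComponentIn (complement A) v :=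
    mem_connectedComponentIn (connectedComponentIn_nonempty_iff.1 ⟨w, hw⟩)
  obtain ⟨z, hz, hz0⟩ := isPreconnected_connectedComponentIn.intermediate_value hw hv
    ρ.continuous_of_finiteDimensional.continuousOn ⟨not_lt.1 h, hρv.le⟩
  exact hR.mem_complement_iff.1 (connectedComponentIn_subset _ _ hz) ρ hρ hz0

theorem exists_apply_eq_zero_of_mem_closure (hR : IsRootSet A R) (hv : v ∈ complement A)
    {f : Fin r → ℝ} (hf : f ∈ closure (connectedComponentIn (complement A) v))
    (hf' : f ∉ connectedComponentIn (complement A) v) : ∃ ρ ∈ R, 0 < ρ v ∧ ρ f = 0 := by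
  have hfA : ¬ IsRegular R f := by
    rw [← hR.mem_complement_iff]
    intro hfA
    have hpre : IsPreconnected (insert f (connectedComponentIn (complement A) v)) :=
      isPreconnected_connectedComponentIn.subset_closure (Set.subset_insert _ _)
        (Set.insert_subset hf subset_closure)
    exact hf' (hpre.subset_connectedComponentIn
      (Set.mem_insert_of_mem _ (mem_connectedComponentIn hv))
      (Set.insert_subset hfA (connectedComponentIn_subset _ _)) (Set.mem_insert _ _))
  simp only [IsRegular, not_forall, not_not] at hfA
  obtain ⟨ρ, hρ, hρf⟩ := hfA
  by_cases hρv : 0 < ρ v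
  · exact ⟨ρ, hρ, hρv, hρf⟩
  · exact ⟨-ρ, hR.neg_mem ρ hρ, (hR.mem_complement_iff.1 hv).neg_pos_of_not_pos hρ hρv,
      neg_eq_zero.2 hρf⟩

theorem exists_pos_smul_coord_mem (hR : IsRootSet A R) (hA : IsSimplicial A)
    (hv : v ∈ complement A) {b : Basis (Fin r) ℝ (Fin r → ℝ)}
    (hK : connectedComponentIn (complement A) v = simplicialCone b) (i : Fin r) :
    ∃ c : ℝ, 0 < c ∧ c • b.coord i ∈ R := by
  obtain ⟨f, hf⟩ : ∃ f, ∀ j, b.coord j f = if j = i then 0 else 1 :=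
    ⟨b.equivFun.symm fun j ↦ if j = i then 0 else 1, fun j ↦
      congrFun (b.equivFun.apply_symm_apply _) j⟩
  have hf_nonneg : ∀ j, 0 ≤ b.coord j f := fun j ↦ by
    rw [hf]
    split_ifs <;> norm_num
  obtain ⟨ρ, hρ, hρv, hρf⟩ := hR.exists_apply_eq_zero_of_mem_closure hv (f := f)
    (by rwa [hK, closure_simplicialCone]) (by rw [hK]; exact fun h ↦ by simpa [hf] using h i)
  have hρ_nonneg : ∀ j, 0 ≤ ρ (b j) := apply_basis_nonneg fun u hu ↦
    (hR.apply_pos_of_mem_connectedComponentIn (hK ▸ hu) hρ hρv).le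
  have hρ_eq : ρ (b i) • b.coord i = ρ := b.ext fun j ↦ by
    rcases eq_or_ne j i with rfl | hj
    · simp
    · have hρj := (apply_basis_eq_zero_or_coord_eq_zero hρ_nonneg hf_nonneg hρf j).resolve_right
        (by rw [hf, if_neg hj]; exact one_ne_zero)
      simp [hρj, hj]
  have hmem : ρ (b i) • b.coord i ∈ R := by rwa [hρ_eq]
  refine ⟨ρ (b i), (hρ_nonneg i).lt_of_ne' fun h ↦ ?_, hmem⟩
  rw [h, zero_smul] at hmem
  exact hR.zero_notMem hA hmem

theorem exists_basis_coord_mem (hR : IsRootSet A R) (hA : IsSimplicial A)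
    (hv : v ∈ complement A) : ∃ e : Basis (Fin r) ℝ (Fin r → ℝ),
      connectedComponentIn (complement A) v = simplicialCone e ∧ ∀ i, e.coord i ∈ R := by
  obtain ⟨b, hK⟩ := (hA.simplicial _ ⟨v, hv, rfl⟩).exists_eq_simplicialCone
  choose c hc hcR using hR.exists_pos_smul_coord_mem hA hv hK
  have hcoord : ∀ i, (b.unitsSMul fun i ↦ (Units.mk0 (c i) (hc i).ne')⁻¹).coord i =
      c i • b.coord i := fun i ↦ by
    rw [Basis.coord_unitsSMul, inv_inv, Units.smul_def, Units.val_mk0]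
  exact ⟨_, hK.trans (simplicialCone_eq_of_coord_eq_smul hc hcoord).symm,
    fun i ↦ hcoord i ▸ hcR i⟩

theorem ker_coord_mem_walls (hR : IsRootSet A R) (hA : IsSimplicial A) {i : Fin r}
    (he : e.coord i ∈ R) : LinearMap.ker (e.coord i) ∈ walls A (simplicialCone e) := by
  refine ⟨hR.ker_mem he, ?_⟩
  rw [span_ker_coord_inter_closure_simplicialCone]
  exact hA.hyperplane _ (hR.ker_mem he)

theorem exists_coord_eq_of_mem_simpleRoots (hR : IsRootSet A R) (hA : IsSimplicial A)
    (he : ∀ i, e.coord i ∈ R) (hρ : ρ ∈ simpleRoots A R (simplicialCone e)) :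
    ∃ i, e.coord i = ρ := by
  obtain ⟨hρR, ⟨hker, hdim⟩, hpos⟩ := hρ
  have hρ_nonneg : ∀ u ∈ simplicialCone e, 0 ≤ ρ u := Set.inter_eq_right.1 hpos
  obtain ⟨i, hi⟩ : ∃ i, ρ (e i) ≠ 0 := by
    by_contra! h
    exact hR.zero_notMem hA ((e.ext h : ρ = 0) ▸ hρR)
  have hker_eq : LinearMap.ker ρ = LinearMap.ker (e.coord i) :=
    (Submodule.eq_of_le_of_finrank_eq (Submodule.span_le.2 Set.inter_subset_left)
      (Nat.add_right_cancel (hdim.trans (hA.hyperplane _ hker).symm))).symm.trans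
    (Submodule.eq_of_le_of_finrank_eq (span_ker_inter_closure_simplicialCone_le hρ_nonneg hi)
      (Nat.add_right_cancel (hdim.trans (hA.hyperplane _ (hR.ker_mem (he i))).symm)))
  refine ⟨i, (hR.eq_or_eq_neg_of_ker_eq (he i) hρR hker_eq).elim Eq.symm fun h ↦ ?_⟩
  have := apply_basis_nonneg hρ_nonneg i
  norm_num [h] at this

theorem simpleRoots_simplicialCone (hR : IsRootSet A R) (hA : IsSimplicial A)
    (he : ∀ i, e.coord i ∈ R) : simpleRoots A R (simplicialCone e) = Set.range e.coord := by
  refine subset_antisymm (fun ρ hρ ↦ hR.exists_coord_eq_of_mem_simpleRoots hA he hρ) ?_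
  rintro _ ⟨i, rfl⟩
  exact ⟨he i, hR.ker_coord_mem_walls hA (he i), Set.inter_eq_right.2 fun u hu ↦ (hu i).le⟩

theorem mem_positiveRoots_iff (hR : IsRootSet A R) (hA : IsSimplicial A) (hv : v ∈ complement A) :
    ρ ∈ positiveRoots A R (connectedComponentIn (complement A) v) ↔ ρ ∈ R ∧ 0 < ρ v := by
  obtain ⟨e, hK, he⟩ := hR.exists_basis_coord_mem hA hv
  have hvK : v ∈ simplicialCone e := hK ▸ mem_connectedComponentIn hv
  rw [positiveRoots, hK, hR.simpleRoots_simplicialCone hA he]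
  refine and_congr_right fun hρ ↦ ⟨fun h ↦ ?_, fun h ↦ ?_⟩
  · refine lt_of_le_of_ne ?_ (hR.mem_complement_iff.1 hv ρ hρ).symm
    clear hρ
    induction h using Submodule.span_induction with
    | mem _ h => obtain ⟨i, rfl⟩ := h; exact (hvK i).le
    | zero => exact le_rfl
    | add σ τ _ _ hσ hτ => exact add_nonneg hσ hτ
    | smul a σ _ hσ => exact mul_nonneg a.2 hσ
  · have hρ_nonneg : ∀ i, 0 ≤ ρ (e i) := apply_basis_nonneg fun u hu ↦
      (hR.apply_pos_of_mem_connectedComponentIn (hK ▸ hu) hρ h).le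
    rw [← e.sum_dual_apply_smul_coord ρ]
    exact Submodule.sum_mem _ fun i _ ↦ Submodule.smul_mem _ (⟨ρ (e i), hρ_nonneg i⟩ : NNReal)
      (Submodule.subset_span ⟨i, rfl⟩)

theorem isBase_simpleRoots (hR : IsRootSet A R) (hA : IsSimplicial A)
    (hcr : IsCrystallographic A R) (hv : v ∈ complement A) :
    IsBase R v (simpleRoots A R (connectedComponentIn (complement A) v)) := by
  obtain ⟨e, hK, he⟩ := hR.exists_basis_coord_mem hA hv
  have hvK : v ∈ simplicialCone e := hK ▸ mem_connectedComponentIn hv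
  have hspan := hcr _ ⟨v, hv, rfl⟩
  rw [hK, hR.simpleRoots_simplicialCone hA he] at hspan ⊢
  refine ⟨Set.range_subset_iff.2 he, Set.forall_mem_range.2 hvK, ?_, fun ρ hρ hρv ↦ ?_⟩
  · rw [← e.coe_dualBasis]
    exact e.dualBasis.linearIndependent.linearIndepOn_id
  have coeff_nat : ∀ i, ∃ n : ℕ, (n : ℝ) = ρ (e i) := fun i ↦ by
    have hρ_nonneg : 0 ≤ ρ (e i) := apply_basis_nonneg (fun u hu ↦
      (hR.apply_pos_of_mem_connectedComponentIn (hK ▸ hu) hρ hρv).le) i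
    have coord_int : ∀ b ∈ Set.range e.coord, ∃ n : ℤ, (n : ℝ) = b (e i) := by
      rintro _ ⟨j, rfl⟩
      exact ⟨if i = j then 1 else 0, by simp [Finsupp.single_apply]⟩
    obtain ⟨n, hn⟩ := exists_intCast_eq_apply_of_mem_span coord_int (hspan hρ)
    lift n to ℕ using (by rw [← hn] at hρ_nonneg; exact_mod_cast hρ_nonneg)
    exact ⟨n, by exact_mod_cast hn⟩
  choose n hn using coeff_nat
  rw [← e.sum_dual_apply_smul_coord ρ]
  refine sum_mem fun i _ ↦ ?_
  rw [← hn, Nat.cast_smul_eq_nsmul]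
  exact nsmul_mem (AddSubmonoid.subset_closure (Set.mem_range_self i)) (n i)

theorem isIntegralSystem (hR : IsRootSet A R) (hA : IsSimplicial A)
    (hcr : IsCrystallographic A R) : IsIntegralSystem R where
  finite := hR.finite hA.finite
  neg_mem := hR.neg_mem
  reduced _ hρ _ hc := hR.reduced hA hρ hc
  exists_isBase _ hv := ⟨_, hR.isBase_simpleRoots hA hcr (hR.mem_complement_iff.2 hv)⟩

end IsRootSet

theorem IsCrystallographic.isAdditive (hcr : IsCrystallographic A R) (hA : IsSimplicial A)
    (hR : IsRootSet A R) : IsAdditive A R := by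
  rintro K ⟨v, hv, rfl⟩ α ⟨hα, hα_simple⟩
  simp only [hR.mem_positiveRoots_iff hA hv] at hα ⊢
  obtain ⟨β, hβ, γ, hγ, hβv, hγv, hsum⟩ :=
    ((hR.isIntegralSystem hA hcr).mem_base_or_exists_eq_add (hR.mem_complement_iff.1 hv)
      (hR.isBase_simpleRoots hA hcr hv) hα.1 hα.2).resolve_left hα_simple
  exact ⟨β, ⟨hβ, hβv⟩, γ, ⟨hγ, hγv⟩, hsum⟩

theorem IsAdditive.mem_span_simpleRoots (had : IsAdditive A R) (hA : IsSimplicial A)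
    (hR : IsRootSet A R) (hv : v ∈ complement A) (hρ : ρ ∈ R) (hρv : 0 < ρ v) :
    ρ ∈ Submodule.span ℤ (simpleRoots A R (connectedComponentIn (complement A) v)) := by
  refine ((hR.finite hA.finite).wellFoundedOn (r := fun ρ σ ↦ ρ v < σ v)).induction
    (P := fun ρ ↦ 0 < ρ v → ρ ∈ Submodule.span ℤ _) hρ (fun ρ hρ ih hρv ↦ ?_) hρv
  by_cases hsimple : ρ ∈ simpleRoots A R (connectedComponentIn (complement A) v)
  · exact Submodule.subset_span hsimple
  obtain ⟨β, hβ, γ, hγ, rfl⟩ :=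
    had _ ⟨v, hv, rfl⟩ ρ ⟨(hR.mem_positiveRoots_iff hA hv).2 ⟨hρ, hρv⟩, hsimple⟩
  obtain ⟨hβ, hβv⟩ := (hR.mem_positiveRoots_iff hA hv).1 hβ
  obtain ⟨hγ, hγv⟩ := (hR.mem_positiveRoots_iff hA hv).1 hγ
  exact add_mem (ih β hβ (lt_add_of_pos_right (β v) hγv) hβv)
    (ih γ hγ (lt_add_of_pos_left (γ v) hβv) hγv)

theorem IsAdditive.isCrystallographic (had : IsAdditive A R) (hA : IsSimplicial A)
    (hR : IsRootSet A R) : IsCrystallographic A R := by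
  rintro K ⟨v, hv, rfl⟩ ρ hρ
  by_cases hρv : 0 < ρ v
  · exact had.mem_span_simpleRoots hA hR hv hρ hρv
  · exact neg_mem_iff.1 (had.mem_span_simpleRoots hA hR hv (hR.neg_mem ρ hρ)
      ((hR.mem_complement_iff.1 hv).neg_pos_of_not_pos hρ hρv))

end RootSet

end Arrangement

theorem mainTheorem2 {r : ℕ} (A : Set (Submodule ℝ (Fin r → ℝ)))
    (R : Set (Module.Dual ℝ (Fin r → ℝ)))
    (hA : Arrangement.IsSimplicial A) (hR : Arrangement.IsRootSet A R) :
    Arrangement.IsCrystallographic A R ↔ Arrangement.IsAdditive A R :=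
  ⟨fun hcr ↦ hcr.isAdditive hA hR, fun had ↦ had.isCrystallographic hA hR⟩
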